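/- A \emph{two-player win-lose coordination game} $G$ consists of two disjoint finite non-empty choice sets $C_1, C_2$ and a set $W_G\subseteq C_1\times C_2$ of winning profiles such that every choice belongs to some winning profile. In the choice matching game $\mathrm{CM}_m$ both players have $m$ choices, and the winning profiles are $m$ pairwise disjoint pairs of choices. In a repeated play the players choose simultaneously and independently in each round, knowing the whole history of the earlier rounds, until a winning profile is chosen for the first time. A stage $(G,\mathcal H)$ is a game with a finite sequence $\mathcal H$ of choice profiles, its history; it is final if $\mathcal H$ contains a winning profile. A \emph{protocol} assigns to every stage $(G,\mathcal H)$ and every player $i$ a probability distribution on $C_i$. It is \emph{structural} if it is invariant under renamings, i.e. under all bijections between the domains of two games that carry choice sets to choice sets (possibly exchanging the two players), the winning relation to the winning relation, and the history to the history round by round. All protocols below are structural. The \emph{expected coordination time} (ECT) of a protocol in $G$ is the expected value in $[0,\infty]$ of the number of rounds until coordination when both players follow the protocol from the empty history. A protocol $\pi$ is \emph{ECT-optimal} for $G$ if no structural protocol has a smaller ECT in $G$. It is \emph{uniquely ECT-optimal} for $G$ if moreover every ECT-optimal protocol $\pi'$ for $G$ prescribes the same distributions as $\pi$ to both players in every non-final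 stage of $G$ that is reached with positive probability when both players follow $\pi$. The \emph{wait-or-move protocol} $\mathrm{WM}$ for two-player games is the following. If each player has so far selected only a single choice (possibly several times), then a player repeats his own choice with probability $\frac12$, and with the remaining probability $\frac12$ he picks, uniformly, one of the choices that form a winning profile with the choice of the other player. If each player has so far selected exactly two choices, then a player picks each of his own two earlier choices with probability $\frac12$. In every other non-final stage, in particular in the first round, he picks uniformly among all his choices. \textbf{Theorem.} For every $m\ge 6$, the protocol $\mathrm{WM}$ is uniquely ECT-optimal for $\mathrm{CM}_m$, and its ECT in $\mathrm{CM}_m$, which is thus the optimal one, equals $3-\frac2m$. -/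

import Mathlib

open scoped ENNReal

/-- An `n`-player win-lose coordination game. The choice sets of the players are given as a family
of types, so they are automatically pairwise disjoint; the domain of the game is their disjoint
union. There are no surely losing choices. -/
structure WLCGame (n : ℕ) where
  /-- `Choice i` is the finite non-empty set of choices of player `i`. -/
  Choice : Fin n → Type
  [fintypeChoice : ∀ i, Fintype (Choice i)]
  [nonemptyChoice : ∀ i, Nonempty (Choice i)]
  /-- The set of winning choice profiles. -/
  Win : Set (∀ i, Choice i)
  noLosingChoice : ∀ (i : Fin n) (c : Choice i), ∃ σ ∈ Win, σ i = c

attribute [instance] WLCGame.fintypeChoice WLCGame.nonemptyChoice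

namespace WLCGame

variable {n : ℕ}

/-- A choice profile: one choice for each player. -/
abbrev Profile (G : WLCGame n) : Type := ∀ i, G.Choice i

/-- The history of the first `k` rounds of a repeated play: the list of the `k` profiles that were
chosen, the most recent round at the head. A stage of a repeated play of `G` is the game `G`
together with a history; the initial stage has the empty history. -/
abbrev History (G : WLCGame n) : Type := List G.Profile

/-- The players have coordinated in some round of the history, so the play is over. -/
def IsFinal (G : WLCGame n) (H : G.History) : Prop := ∃ σ ∈ H, σ ∈ G.Win

/-- A renaming between the stages `(G, H)` and `(G', H')`: a permutation `β` of the players and a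
bijection between the domains that takes the choices of player `β i` in `G` to the choices
of player `i` in `G'`, and that respects the winning relation and each round of the history. -/
structure Renaming (G G' : WLCGame n) (H : G.History) (H' : G'.History) where
  β : Equiv.Perm (Fin n)
  toEquiv : ∀ i, G.Choice (β i) ≃ G'.Choice i
  win_iff : ∀ σ : G.Profile, σ ∈ G.Win ↔ (fun i => toEquiv i (σ (β i))) ∈ G'.Win
  history_eq : H' = H.map fun σ i => toEquiv i (σ (β i))

end WLCGame

/-- The choice matching game with `n` players and `m` choices for each player: its winning profiles
are the `m` pairwise disjoint profiles in which all the players pick the same row. -/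
def choiceMatching (n m : ℕ) (hm : 0 < m) : WLCGame n where
  Choice := fun _ => Fin m
  nonemptyChoice := fun _ => ⟨⟨0, hm⟩⟩
  Win := {σ | ∃ a : Fin m, ∀ i, σ i = a}
  noLosingChoice := fun _ c => ⟨fun _ => c, ⟨c, fun _ => rfl⟩, rfl⟩

/-- A protocol (for `n`-player games): a probability distribution on the choices of player `i`
for every stage `(G, H)` and every player `i`. -/
structure Protocol (n : ℕ) where
  prob : ∀ (G : WLCGame n) (_ : G.History) (i : Fin n), G.Choice i → ℝ
  prob_nonneg : ∀ (G : WLCGame n) (H : G.History) (i : Fin n) (c : G.Choice i),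
    0 ≤ prob G H i c
  sum_prob : ∀ (G : WLCGame n) (H : G.History) (i : Fin n), ∑ c, prob G H i c = 1

namespace Protocol

variable {n : ℕ}

/-- A protocol is structural if it is indifferent with respect to renamings. -/
def IsStructural (P : Protocol n) : Prop :=
  ∀ (G G' : WLCGame n) (H : G.History) (H' : G'.History) (r : G.Renaming G' H H')
    (i : Fin n) (c : G.Choice (r.β i)),
    P.prob G H (r.β i) c = P.prob G' H' i (r.toEquiv i c)

/-- The probability that the profile `σ` is chosen in the next round after the stage `(G, H)`
when all players follow `P`, each of them choosing independently of the others. -/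
noncomputable def profileProb (P : Protocol n) (G : WLCGame n) (H : G.History)
    (σ : G.Profile) : ℝ :=
  ∏ i, P.prob G H i (σ i)

open Classical in
/-- The probability that, when all players follow `P` from the stage `(G, H)` on, the number of
further rounds until coordination is exactly `k`. -/
noncomputable def timeProb (P : Protocol n) (G : WLCGame n) : ℕ → G.History → ℝ
  | 0, H => if G.IsFinal H then 1 else 0
  | k + 1, H => if G.IsFinal H then 0 else
      ∑ σ : G.Profile, P.profileProb G H σ * timeProb P G k (σ :: H)

/-- The expected coordination time from the stage `(G, H)` with `P`: the expected value of the
number of rounds until coordination. This number is `∞` on the plays that never coordinate, whose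
probability is the mass missing from the finite values. -/
noncomputable def ect (P : Protocol n) (G : WLCGame n) (H : G.History) : ℝ≥0∞ :=
  ∑' k : ℕ, (k : ℝ≥0∞) * ENNReal.ofReal (P.timeProb G k H) +
    ∞ * (1 - ∑' k : ℕ, ENNReal.ofReal (P.timeProb G k H))

/-- The stages of `G` that occur with positive probability in a repeated play, which goes on until
the first coordination, when all players follow `P`. -/
inductive Reachable (P : Protocol n) (G : WLCGame n) : G.History → Prop
  | initial : Reachable P G []
  | step (H : G.History) (σ : G.Profile) : Reachable P G H → ¬ G.IsFinal H →
      0 < P.profileProb G H σ → Reachable P G (σ :: H)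

/-- `P` is ECT-optimal for `G`: it is structural and gives the minimum expected coordination time
in `G` among all structural protocols. -/
def IsECTOptimal (P : Protocol n) (G : WLCGame n) : Prop :=
  P.IsStructural ∧ ∀ Q : Protocol n, Q.IsStructural → P.ect G [] ≤ Q.ect G []

/-- `P` is uniquely ECT-optimal for `G`: it is ECT-optimal, and every ECT-optimal protocol agrees
with `P` on all stages of `G` that are reachable with `P` and in which play still continues. -/
def IsUniquelyECTOptimal (P : Protocol n) (G : WLCGame n) : Prop :=
  P.IsECTOptimal G ∧ ∀ Q : Protocol n, Q.IsECTOptimal G →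
    ∀ H : G.History, P.Reachable G H → ¬ G.IsFinal H →
      ∀ (i : Fin n) (c : G.Choice i), Q.prob G H i c = P.prob G H i c

end Protocol

namespace WaitOrMove

open Classical in
/-- The set of choices that player `i` has selected in the history. -/
noncomputable def chosen {n : ℕ} (G : WLCGame n) (H : G.History) (i : Fin n) :
    Finset (G.Choice i) :=
  {c | ∃ σ ∈ H, σ i = c}

open Classical in
/-- The choices of player `i` in a two-player game that coordinate with some earlier choice of the
other player `i.rev`. -/
noncomputable def coordinating (G : WLCGame 2) (H : G.History) (i : Fin 2) :
    Finset (G.Choice i) :=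
  {c | ∃ d ∈ chosen G H i.rev, ∃ σ ∈ G.Win, σ i = c ∧ σ i.rev = d}

open Classical in
/-- The distribution that wait-or-move prescribes to player `i`. If both players have selected only
a single choice, player `i` repeats the own choice with probability `1/2`, and the other half
is shared equally by the choices that coordinate with the choice of the other player (as long as
the play continues, the own choice is not among these). If both players have selected exactly two
choices, player `i` picks each of the two own choices with probability `1/2`. In all other cases,
in particular in the first round, player `i` picks uniformly among all choices. -/
noncomputable def prob (G : WLCGame 2) (H : G.History) (i : Fin 2) (c : G.Choice i) : ℝ :=
  if ∀ j, (chosen G H j).card = 1 then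
    (if c ∈ chosen G H i then 1 / 2 else 0) +
      (if c ∈ coordinating G H i then 1 / (2 * ((coordinating G H i).card : ℝ)) else 0)
  else if ∀ j, (chosen G H j).card = 2 then
    (if c ∈ chosen G H i then 1 / 2 else 0)
  else 1 / (Fintype.card (G.Choice i) : ℝ)

theorem prob_nonneg (G : WLCGame 2) (H : G.History) (i : Fin 2) (c : G.Choice i) :
    0 ≤ prob G H i c := by
  unfold prob
  split_ifs <;> positivity

theorem sum_prob (G : WLCGame 2) (H : G.History) (i : Fin 2) : ∑ c, prob G H i c = 1 := by
  classical
  unfold prob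
  split_ifs with h1 h2
  · have hne : (coordinating G H i).Nonempty := by
      obtain ⟨d, hd⟩ := Finset.card_pos.mp (by rw [h1 i.rev]; exact one_pos)
      obtain ⟨σ, hσ, hd'⟩ := G.noLosingChoice i.rev d
      exact ⟨σ i, Finset.mem_filter.mpr ⟨Finset.mem_univ _, d, hd, σ, hσ, rfl, hd'⟩⟩
    have hpos : (0 : ℝ) < (coordinating G H i).card := by exact_mod_cast hne.card_pos
    rw [Finset.sum_add_distrib, Finset.sum_ite_mem, Finset.sum_ite_mem]
    simp only [Finset.univ_inter, Finset.sum_const, nsmul_eq_mul, h1 i]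
    field_simp
    norm_num
  · rw [Finset.sum_ite_mem]
    simp only [Finset.univ_inter, Finset.sum_const, nsmul_eq_mul, h2 i]
    norm_num
  · have hpos : (0 : ℝ) < Fintype.card (G.Choice i) := by exact_mod_cast Fintype.card_pos
    simp only [Finset.sum_const, nsmul_eq_mul, Finset.card_univ]
    field_simp

end WaitOrMove

/-- The wait-or-move protocol for repeated two-player games. -/
noncomputable def waitOrMove : Protocol 2 where
  prob := WaitOrMove.prob
  prob_nonneg := WaitOrMove.prob_nonneg
  sum_prob := WaitOrMove.sum_prob

/-!
The expected coordination time `E` is the sum of the survival probabilities. Hence, at non-final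
stages, `E` is one plus the mean of `E` at the next stage; it lies below every supersolution of this
equation and above every bounded subsolution.

A choice matching game has no distinguished rows, so a structural protocol starts with the uniform
distribution. After a miss, exchanging the two players and the two selected rows is a symmetry of
the stage, and the distribution of one player is the image of that of the other. This persists as
long as the players only repeat such pairs of rows or open new ones. The potential that is `2`,
`3 / 2` or `1` on these stages, according to the number of untouched rows, and `1` on all other
non-final stages is a subsolution. If at least four rows are untouched, then selecting them with
total probability `r` costs at least `r ^ 2 / 8`, and a bias between two paired rows costs the
square of the bias. So for `m ≥ 6` the minimum `2` after a miss is attained only by the fair coin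
toss between the two rows, which is what wait-or-move prescribes.
-/

section Expectation

variable {ι : Type*}

theorem le_of_sum_le_sum_of_le {s : Finset ι} {f g : ι → ℝ≥0∞} (hfg : ∀ i ∈ s, f i ≤ g i)
    (hf : ∑ i ∈ s, f i ≠ ∞) (hgf : ∑ i ∈ s, g i ≤ ∑ i ∈ s, f i) {i : ι} (hi : i ∈ s) :
    g i ≤ f i := by
  classical
  rw [← Finset.add_sum_erase s f hi] at hf hgf
  rw [← Finset.add_sum_erase s g hi] at hgf
  refine (ENNReal.add_le_add_iff_right (ENNReal.add_ne_top.1 hf).2).1 (le_trans ?_ hgf)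
  gcongr with j hj
  exact hfg j (Finset.mem_of_mem_erase hj)

/-- `a` is the distribution of a time with values in `ℕ ∪ {∞}`, and `s` is its tail. -/
theorem tsum_natCast_mul_add_top_mul_eq_tsum_tail {a s : ℕ → ℝ≥0∞}
    (h : ∀ k, s k + ∑ j ∈ Finset.range (k + 1), a j = 1) :
    ∑' k : ℕ, (k : ℝ≥0∞) * a k + ∞ * (1 - ∑' k, a k) = ∑' k, s k := by
  have hA : ∑' k, a k ≤ 1 := by
    rw [ENNReal.tsum_eq_iSup_nat' (Filter.tendsto_add_atTop_nat 1)]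
    exact iSup_le fun k => (h k).le.trans' le_add_self
  have hs : ∀ k, s k = (∑' j, if k < j then a j else 0) + (1 - ∑' j, a j) := by
    intro k
    have hfin : ∑ j ∈ Finset.range (k + 1), a j ≠ ∞ :=
      ne_top_of_le_ne_top ENNReal.one_ne_top ((h k).le.trans' le_add_self)
    have hsplit : (∑' j, if k < j then a j else 0) + ∑ j ∈ Finset.range (k + 1), a j =
        ∑' j, a j := by
      rw [sum_eq_tsum_indicator, ← ENNReal.tsum_add]
      refine tsum_congr fun j => ?_
      by_cases hj : k < j
      · simp [hj]
      · simp [hj, not_lt.1 hj]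
    rw [← ENNReal.add_left_inj hfin, h k, add_right_comm, hsplit, add_tsub_cancel_of_le hA]
  have hmean : ∑' k : ℕ, (k : ℝ≥0∞) * a k = ∑' k, ∑' j, if k < j then a j else 0 := by
    rw [ENNReal.tsum_comm]
    refine tsum_congr fun j => ?_
    rw [tsum_eq_sum (s := Finset.range j) fun k hk => if_neg (by simpa using hk),
      Finset.sum_congr rfl fun k hk => if_pos (Finset.mem_range.1 hk), Finset.sum_const,
      Finset.card_range, nsmul_eq_mul]
  simp only [hs, ENNReal.tsum_add, hmean, ENNReal.tsum_const]
  simp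

end Expectation

namespace Protocol

variable {n : ℕ} (P : Protocol n) (G : WLCGame n) {H : G.History}

theorem profileProb_nonneg (H : G.History) (σ : G.Profile) : 0 ≤ P.profileProb G H σ :=
  Finset.prod_nonneg fun i _ => P.prob_nonneg G H i (σ i)

theorem sum_profileProb (H : G.History) : ∑ σ, P.profileProb G H σ = 1 := by
  classical
  simp only [profileProb]
  rw [← Fintype.prod_sum fun i c => P.prob G H i c]
  exact Finset.prod_eq_one fun i _ => P.sum_prob G H i

theorem timeProb_nonneg (k : ℕ) (H : G.History) : 0 ≤ P.timeProb G k H := by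
  induction k generalizing H with
  | zero => unfold timeProb; split_ifs <;> norm_num
  | succ k ih =>
    unfold timeProb
    split_ifs
    · exact le_rfl
    · exact Finset.sum_nonneg fun σ _ => mul_nonneg (P.profileProb_nonneg G H σ) (ih _)

/-- The expected value of `f` at the stage that follows `(G, H)` when all players follow `P`. -/
noncomputable def nextMean (H : G.History) (f : G.History → ℝ≥0∞) : ℝ≥0∞ :=
  ∑ σ, ENNReal.ofReal (P.profileProb G H σ) * f (σ :: H)

theorem nextMean_mono {f g : G.History → ℝ≥0∞} (hfg : ∀ H, f H ≤ g H) :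
    P.nextMean G H f ≤ P.nextMean G H g :=
  Finset.sum_le_sum fun σ _ => mul_le_mul_right (hfg (σ :: H)) _

theorem nextMean_one : P.nextMean G H (fun _ => 1) = 1 := by
  simp only [nextMean, mul_one]
  rw [← ENNReal.ofReal_sum_of_nonneg fun σ _ => P.profileProb_nonneg G H σ, sum_profileProb,
    ENNReal.ofReal_one]

theorem nextMean_add (f g : G.History → ℝ≥0∞) :
    P.nextMean G H (fun H => f H + g H) = P.nextMean G H f + P.nextMean G H g := by
  simp only [nextMean, mul_add, Finset.sum_add_distrib]

theorem nextMean_const_mul (a : ℝ≥0∞) (f : G.History → ℝ≥0∞) :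
    P.nextMean G H (fun H => a * f H) = a * P.nextMean G H f := by
  simp only [nextMean, mul_left_comm _ a, Finset.mul_sum]

theorem nextMean_sum {ι : Type*} (s : Finset ι) (f : ι → G.History → ℝ≥0∞) :
    P.nextMean G H (fun H => ∑ k ∈ s, f k H) = ∑ k ∈ s, P.nextMean G H (f k) := by
  simp only [nextMean, Finset.mul_sum]
  exact Finset.sum_comm

theorem nextMean_tsum {ι : Type*} (f : ι → G.History → ℝ≥0∞) :
    P.nextMean G H (fun H => ∑' k, f k H) = ∑' k, P.nextMean G H (f k) := by
  simp only [nextMean, ← ENNReal.tsum_mul_left]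
  exact (Summable.tsum_finsetSum fun _ _ => ENNReal.summable).symm

theorem nextMean_ofReal {f : G.History → ℝ} (hf : ∀ H, 0 ≤ f H) :
    P.nextMean G H (fun H => ENNReal.ofReal (f H)) =
      ENNReal.ofReal (∑ σ, P.profileProb G H σ * f (σ :: H)) := by
  rw [ENNReal.ofReal_sum_of_nonneg fun σ _ => mul_nonneg (P.profileProb_nonneg G H σ) (hf _)]
  exact Finset.sum_congr rfl fun σ _ => (ENNReal.ofReal_mul (P.profileProb_nonneg G H σ)).symm

open Classical in
/-- The probability that, when all players follow `P` from the stage `(G, H)` on, they have not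
coordinated after `k` further rounds. -/
noncomputable def survivalProb : ℕ → G.History → ℝ≥0∞
  | 0, H => if G.IsFinal H then 0 else 1
  | k + 1, H => if G.IsFinal H then 0 else P.nextMean G H fun H => survivalProb k H

theorem survivalProb_of_isFinal (h : G.IsFinal H) (k : ℕ) : P.survivalProb G k H = 0 := by
  cases k <;> simp [survivalProb, h]

theorem survivalProb_zero_of_not_isFinal (h : ¬ G.IsFinal H) : P.survivalProb G 0 H = 1 := by
  simp [survivalProb, h]

theorem survivalProb_succ_of_not_isFinal (h : ¬ G.IsFinal H) (k : ℕ) :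
    P.survivalProb G (k + 1) H = P.nextMean G H (P.survivalProb G k) := by
  simp [survivalProb, h]

theorem ofReal_timeProb_succ_of_not_isFinal (h : ¬ G.IsFinal H) (k : ℕ) :
    ENNReal.ofReal (P.timeProb G (k + 1) H) =
      P.nextMean G H fun H => ENNReal.ofReal (P.timeProb G k H) := by
  rw [P.nextMean_ofReal G (P.timeProb_nonneg G k)]
  simp [timeProb, h]

theorem survivalProb_add_sum_timeProb (k : ℕ) (H : G.History) :
    P.survivalProb G k H + ∑ j ∈ Finset.range (k + 1), ENNReal.ofReal (P.timeProb G j H) = 1 := by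
  induction k generalizing H with
  | zero => by_cases h : G.IsFinal H <;> simp [survivalProb, timeProb, h]
  | succ k ih =>
    rw [Finset.sum_range_succ']
    by_cases h : G.IsFinal H
    · simp [survivalProb, timeProb, h]
    · have h0 : P.timeProb G 0 H = 0 := by simp [timeProb, h]
      simp only [P.survivalProb_succ_of_not_isFinal G h,
        P.ofReal_timeProb_succ_of_not_isFinal G h, h0, ENNReal.ofReal_zero, add_zero]
      rw [← nextMean_sum, ← nextMean_add]
      simp only [ih, nextMean_one]

theorem ect_eq_tsum_survivalProb (H : G.History) : P.ect G H = ∑' k, P.survivalProb G k H :=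
  tsum_natCast_mul_add_top_mul_eq_tsum_tail fun k => P.survivalProb_add_sum_timeProb G k H

theorem ect_of_isFinal (h : G.IsFinal H) : P.ect G H = 0 := by
  simp only [ect_eq_tsum_survivalProb, P.survivalProb_of_isFinal G h, tsum_zero]

theorem ect_of_not_isFinal (h : ¬ G.IsFinal H) : P.ect G H = 1 + P.nextMean G H (P.ect G) := by
  rw [ect_eq_tsum_survivalProb, tsum_eq_zero_add' ENNReal.summable,
    P.survivalProb_zero_of_not_isFinal G h]
  simp only [P.survivalProb_succ_of_not_isFinal G h]
  rw [← nextMean_tsum]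
  simp only [← ect_eq_tsum_survivalProb]

theorem sum_range_succ_survivalProb (h : ¬ G.IsFinal H) (N : ℕ) :
    ∑ k ∈ Finset.range (N + 1), P.survivalProb G k H =
      1 + P.nextMean G H fun H => ∑ k ∈ Finset.range N, P.survivalProb G k H := by
  rw [Finset.sum_range_succ', P.survivalProb_zero_of_not_isFinal G h, add_comm, nextMean_sum]
  simp only [P.survivalProb_succ_of_not_isFinal G h]

theorem ect_le_of_one_add_nextMean_le {f : G.History → ℝ≥0∞}
    (hf : ∀ H, ¬ G.IsFinal H → 1 + P.nextMean G H f ≤ f H) (H : G.History) : P.ect G H ≤ f H := by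
  rw [ect_eq_tsum_survivalProb, ENNReal.tsum_eq_iSup_nat]
  refine iSup_le fun N => ?_
  induction N generalizing H with
  | zero => simp
  | succ N ih =>
    by_cases h : G.IsFinal H
    · simp [P.survivalProb_of_isFinal G h]
    · rw [P.sum_range_succ_survivalProb G h]
      exact (add_le_add_right (P.nextMean_mono G ih) 1).trans (hf H h)

theorem le_sum_survivalProb_add_mul {f : G.History → ℝ≥0∞} {b : ℝ≥0∞} (hb : ∀ H, f H ≤ b)
    (hfinal : ∀ H, G.IsFinal H → f H = 0)
    (hf : ∀ H, ¬ G.IsFinal H → f H ≤ 1 + P.nextMean G H f) (N : ℕ) (H : G.History) :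
    f H ≤ ∑ k ∈ Finset.range N, P.survivalProb G k H + b * P.survivalProb G N H := by
  induction N generalizing H with
  | zero =>
    by_cases h : G.IsFinal H
    · simp [hfinal H h]
    · simpa [P.survivalProb_zero_of_not_isFinal G h] using hb H
  | succ N ih =>
    by_cases h : G.IsFinal H
    · simp [hfinal H h]
    calc f H ≤ 1 + P.nextMean G H f := hf H h
      _ ≤ 1 + P.nextMean G H fun H =>
            ∑ k ∈ Finset.range N, P.survivalProb G k H + b * P.survivalProb G N H := by
          gcongr
          exact P.nextMean_mono G ih
      _ = _ := by
          rw [nextMean_add, nextMean_const_mul, ← add_assoc, P.sum_range_succ_survivalProb G h,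
            P.survivalProb_succ_of_not_isFinal G h]

/-- Unless the expected time is infinite, the survival probabilities tend to `0`, and with them the
error of stopping the play after `N` rounds. -/
theorem le_ect_of_le_one_add_nextMean {f : G.History → ℝ≥0∞} {b : ℝ≥0∞} (hb : ∀ H, f H ≤ b)
    (hb_top : b ≠ ∞) (hfinal : ∀ H, G.IsFinal H → f H = 0)
    (hf : ∀ H, ¬ G.IsFinal H → f H ≤ 1 + P.nextMean G H f) (H : G.History) :
    f H ≤ P.ect G H := by
  by_cases htop : P.ect G H = ∞
  · simp [htop]
  rw [ect_eq_tsum_survivalProb] at htop ⊢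
  have hlim : Filter.Tendsto (fun N => ∑ k ∈ Finset.range N, P.survivalProb G k H +
      b * P.survivalProb G N H) Filter.atTop (nhds (∑' k, P.survivalProb G k H + b * 0)) :=
    (ENNReal.tendsto_nat_tsum _).add (ENNReal.Tendsto.const_mul
      (ENNReal.tendsto_atTop_zero_of_tsum_ne_top htop) (Or.inr hb_top))
  rw [mul_zero, add_zero] at hlim
  exact ge_of_tendsto' hlim fun N => P.le_sum_survivalProb_add_mul G hb hfinal hf N H

variable {P G}

theorem ect_ne_top_of_reachable (hfin : P.ect G [] ≠ ∞) (hH : P.Reachable G H) :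
    P.ect G H ≠ ∞ := by
  induction hH with
  | initial => exact hfin
  | step H σ _ h hσ ih =>
    rw [P.ect_of_not_isFinal G h] at ih
    have hterm := ENNReal.sum_ne_top.1 (ENNReal.add_ne_top.1 ih).2 σ (Finset.mem_univ σ)
    exact fun htop => hterm (by rw [htop, ENNReal.mul_top (ENNReal.ofReal_pos.2 hσ).ne'])

theorem ect_cons_le_of_ect_le {Q : Protocol n} (h : ¬ G.IsFinal H)
    (hprob : Q.profileProb G H = P.profileProb G H)
    (hPQ : ∀ σ, 0 < P.profileProb G H σ → P.ect G (σ :: H) ≤ Q.ect G (σ :: H))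
    (hfin : P.ect G H ≠ ∞) (hQP : Q.ect G H ≤ P.ect G H)
    {σ : G.Profile} (hσ : 0 < P.profileProb G H σ) : Q.ect G (σ :: H) ≤ P.ect G (σ :: H) := by
  rw [P.ect_of_not_isFinal G h] at hfin hQP
  rw [Q.ect_of_not_isFinal G h, ENNReal.add_le_add_iff_left ENNReal.one_ne_top] at hQP
  simp only [nextMean, hprob] at hQP
  have hmul := le_of_sum_le_sum_of_le (fun ρ _ => ?_) (ENNReal.add_ne_top.1 hfin).2 hQP
    (Finset.mem_univ σ)
  · exact (ENNReal.mul_le_mul_iff_right (ENNReal.ofReal_pos.2 hσ).ne' ENNReal.ofReal_ne_top).1 hmul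
  · rcases (P.profileProb_nonneg G H ρ).eq_or_lt with hρ | hρ
    · simp [← hρ]
    · gcongr
      exact hPQ ρ hρ

theorem isUniquelyECTOptimal_of_forall_reachable (hP : P.IsStructural) (hfin : P.ect G [] ≠ ∞)
    (hopt : ∀ H, P.Reachable G H → ∀ Q : Protocol n, Q.IsStructural → P.ect G H ≤ Q.ect G H)
    (huniq : ∀ H, P.Reachable G H → ¬ G.IsFinal H → ∀ Q : Protocol n, Q.IsStructural →
      Q.ect G H ≤ P.ect G H → ∀ i c, Q.prob G H i c = P.prob G H i c) :
    P.IsUniquelyECTOptimal G := by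
  refine ⟨⟨hP, hopt [] .initial⟩, fun Q hQ H hH h => huniq H hH h Q hQ.1 ?_⟩
  clear h
  induction hH with
  | initial => exact hQ.2 P hP
  | step H σ hH h hσ ih =>
    have hprob : Q.profileProb G H = P.profileProb G H :=
      funext fun ρ => Finset.prod_congr rfl fun i _ => huniq H hH h Q hQ.1 ih i (ρ i)
    exact ect_cons_le_of_ect_le h hprob (fun ρ hρ => hopt _ (.step H ρ hH h hρ) Q hQ.1)
      (ect_ne_top_of_reachable hfin hH) ih hσ

end Protocol

theorem WLCGame.Renaming.exists_profile_eq {n : ℕ} {G G' : WLCGame n} {H : G.History}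
    {H' : G'.History} (r : G.Renaming G' H H') (σ' : G'.Profile) :
    ∃ σ : G.Profile, (fun i => r.toEquiv i (σ (r.β i))) = σ' := by
  refine ⟨Equiv.piCongrLeft _ r.β fun i => (r.toEquiv i).symm (σ' i), ?_⟩
  funext i
  rw [Equiv.piCongrLeft_apply_apply, Equiv.apply_symm_apply]

namespace WaitOrMove

open WLCGame

theorem mem_chosen {n : ℕ} {G : WLCGame n} {H : G.History} {i : Fin n} {c : G.Choice i} :
    c ∈ chosen G H i ↔ ∃ σ ∈ H, σ i = c := by
  simp [chosen]

theorem mem_coordinating {G : WLCGame 2} {H : G.History} {i : Fin 2} {c : G.Choice i} :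
    c ∈ coordinating G H i ↔ ∃ ρ ∈ H, ∃ σ ∈ G.Win, σ i = c ∧ σ i.rev = ρ i.rev := by
  simp only [coordinating, mem_chosen, Finset.mem_filter, Finset.mem_univ, true_and]
  constructor
  · rintro ⟨_, ⟨ρ, hρ, rfl⟩, σ, hσ, hc, hd⟩
    exact ⟨ρ, hρ, σ, hσ, hc, hd⟩
  · rintro ⟨ρ, hρ, σ, hσ, hc, hd⟩
    exact ⟨_, ⟨ρ, hρ, rfl⟩, σ, hσ, hc, hd⟩

theorem chosen_eq_map {n : ℕ} {G G' : WLCGame n} {H : G.History} {H' : G'.History}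
    (r : G.Renaming G' H H') (i : Fin n) :
    chosen G' H' i = (chosen G H (r.β i)).map (r.toEquiv i).toEmbedding := by
  ext c
  simp only [mem_chosen, r.history_eq, List.mem_map, Finset.mem_map, Equiv.coe_toEmbedding]
  constructor <;>
  · rintro ⟨_, ⟨σ, hσ, rfl⟩, rfl⟩
    exact ⟨_, ⟨σ, hσ, rfl⟩, rfl⟩

theorem rev_perm_apply (β : Equiv.Perm (Fin 2)) (i : Fin 2) : (β i).rev = β i.rev := by
  revert β i; decide

theorem coordinating_eq_map {G G' : WLCGame 2} {H : G.History} {H' : G'.History}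
    (r : G.Renaming G' H H') (i : Fin 2) :
    coordinating G' H' i = (coordinating G H (r.β i)).map (r.toEquiv i).toEmbedding := by
  ext c
  simp only [mem_coordinating, r.history_eq, List.mem_map, Finset.mem_map,
    Equiv.coe_toEmbedding]
  constructor
  · rintro ⟨_, ⟨ρ, hρ, rfl⟩, σ', hσ', rfl, hσρ⟩
    obtain ⟨σ, rfl⟩ := r.exists_profile_eq σ'
    exact ⟨σ (r.β i), ⟨ρ, hρ, σ, (r.win_iff σ).2 hσ', rfl,
      rev_perm_apply r.β i ▸ (r.toEquiv _).injective hσρ⟩, rfl⟩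
  · rintro ⟨_, ⟨ρ, hρ, σ, hσ, rfl, hσρ⟩, rfl⟩
    exact ⟨_, ⟨ρ, hρ, rfl⟩, _, (r.win_iff σ).1 hσ, rfl,
      congrArg _ (rev_perm_apply r.β i ▸ hσρ)⟩

theorem waitOrMove_isStructural : waitOrMove.IsStructural := by
  intro G G' H H' r i c
  have hcard_chosen (k : ℕ) :
      (∀ j, (chosen G' H' j).card = k) ↔ ∀ j, (chosen G H j).card = k := by
    simp only [chosen_eq_map r, Finset.card_map]
    exact r.β.forall_congr_right (q := fun j => (chosen G H j).card = k)
  have hcard_choice : Fintype.card (G'.Choice i) = Fintype.card (G.Choice (r.β i)) :=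
    Fintype.card_congr (r.toEquiv i).symm
  have hmem_chosen : c ∈ chosen G H (r.β i) ↔ r.toEquiv i c ∈ chosen G' H' i := by
    rw [chosen_eq_map r]; simp
  have hmem_coord : c ∈ coordinating G H (r.β i) ↔ r.toEquiv i c ∈ coordinating G' H' i := by
    rw [coordinating_eq_map r]; simp
  have hcard_coord : (coordinating G' H' i).card = (coordinating G H (r.β i)).card := by
    rw [coordinating_eq_map r, Finset.card_map]
  change prob G H (r.β i) c = prob G' H' i (r.toEquiv i c)
  unfold prob
  simp only [hcard_chosen, hcard_coord, hcard_choice]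
  classical
  exact if_congr Iff.rfl
    (congrArg₂ _ (if_congr hmem_chosen rfl rfl) (if_congr hmem_coord rfl rfl))
    (if_congr Iff.rfl (if_congr hmem_chosen rfl rfl) rfl)

end WaitOrMove

namespace ChoiceMatching

open WLCGame WaitOrMove

section Rows

variable {n m : ℕ} {hm : 0 < m}

/-- The row of player `i` in the profile `σ`. The choices of all players are the elements of
`Fin m`, so the rows of different players can be compared. -/
def row (σ : (choiceMatching n m hm).Profile) (i : Fin n) : Fin m := σ i

/-- The probability that `P` prescribes to player `i` for the row `c`. -/
def rowProb (P : Protocol n) (H : (choiceMatching n m hm).History) (i : Fin n) (c : Fin m) : ℝ :=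
  P.prob (choiceMatching n m hm) H i c

/-- The rows of the choices that player `i` has selected in the history. -/
noncomputable def chosenRows (H : (choiceMatching n m hm).History) (i : Fin n) : Finset (Fin m) :=
  chosen (choiceMatching n m hm) H i

/-- The rows in which some player has selected a choice in the history. -/
noncomputable def touched (H : (choiceMatching n m hm).History) : Finset (Fin m) :=
  Finset.univ.biUnion (chosenRows H)

variable {P : Protocol n} {H : (choiceMatching n m hm).History}

theorem rowProb_nonneg (P : Protocol n) (H : (choiceMatching n m hm).History) (i : Fin n)
    (c : Fin m) : 0 ≤ rowProb P H i c :=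
  P.prob_nonneg _ _ _ _

theorem sum_rowProb (P : Protocol n) (H : (choiceMatching n m hm).History) (i : Fin n) :
    ∑ c, rowProb P H i c = 1 :=
  P.sum_prob (choiceMatching n m hm) H i

theorem mem_chosenRows {i : Fin n} {c : Fin m} : c ∈ chosenRows H i ↔ ∃ σ ∈ H, row σ i = c :=
  mem_chosen

theorem mem_touched {c : Fin m} : c ∈ touched H ↔ ∃ σ ∈ H, ∃ i, row σ i = c := by
  simp only [touched, Finset.mem_biUnion, Finset.mem_univ, true_and, mem_chosenRows]
  tauto

theorem row_mem_touched {σ : (choiceMatching n m hm).Profile} (hσ : σ ∈ H) (i : Fin n) :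
    row σ i ∈ touched H :=
  mem_touched.2 ⟨σ, hσ, i, rfl⟩

theorem rowProb_apply_eq (hP : P.IsStructural) (β : Equiv.Perm (Fin n)) (τ : Equiv.Perm (Fin m))
    (h : ∀ σ ∈ H, ∀ i, τ (row σ (β i)) = row σ i) (i : Fin n) (c : Fin m) :
    rowProb P H (β i) c = rowProb P H i (τ c) :=
  hP (choiceMatching n m hm) (choiceMatching n m hm) H H
    { β := β
      toEquiv := fun _ => τ
      win_iff := fun σ => by
        constructor
        · rintro ⟨a, ha⟩
          exact ⟨τ a, fun i => congrArg τ (ha (β i))⟩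
        · rintro ⟨a, ha⟩
          refine ⟨τ.symm a, β.forall_congr_right.1 fun i => ?_⟩
          exact (Equiv.eq_symm_apply τ).2 (ha i)
      history_eq :=
        ((List.map_congr_left fun σ hσ => funext (h σ hσ)).trans (List.map_id H)).symm } i c

theorem rowProb_eq_of_notMem_touched (hP : P.IsStructural) (i : Fin n) {c d : Fin m}
    (hc : c ∉ touched H) (hd : d ∉ touched H) : rowProb P H i c = rowProb P H i d := by
  have hswap : ∀ σ ∈ H, ∀ i, Equiv.swap c d (row σ i) = row σ i := fun σ hσ i =>
    Equiv.swap_apply_of_ne_of_ne (ne_of_mem_of_not_mem (row_mem_touched hσ i) hc)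
      (ne_of_mem_of_not_mem (row_mem_touched hσ i) hd)
  simpa using rowProb_apply_eq hP 1 (Equiv.swap c d) hswap i c

theorem rowProb_nil (hP : P.IsStructural) (i : Fin n) (c : Fin m) :
    rowProb P ([] : (choiceMatching n m hm).History) i c = 1 / m := by
  have huntouched (d : Fin m) : d ∉ touched ([] : (choiceMatching n m hm).History) := by
    simp [mem_touched]
  have hsum := sum_rowProb P ([] : (choiceMatching n m hm).History) i
  simp only [fun d => rowProb_eq_of_notMem_touched hP i (huntouched d) (huntouched c),
    Finset.sum_const, Finset.card_univ, Fintype.card_fin, nsmul_eq_mul] at hsum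
  exact eq_one_div_of_mul_eq_one_right hsum

end Rows

section TwoPlayers

variable {m : ℕ} {hm : 0 < m} {P : Protocol 2} {H : (choiceMatching 2 m hm).History}

variable (hm) in
/-- The profile in which player `0` picks the row `c` and player `1` the row `d`. -/
def pair (c d : Fin m) : (choiceMatching 2 m hm).Profile :=
  (piFinTwoEquiv (choiceMatching 2 m hm).Choice).symm (c, d)

@[simp] theorem row_pair_zero (c d : Fin m) : row (pair hm c d) 0 = c := rfl

@[simp] theorem row_pair_one (c d : Fin m) : row (pair hm c d) 1 = d := rfl

theorem sum_profile {M : Type*} [AddCommMonoid M] (f : (choiceMatching 2 m hm).Profile → M) :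
    ∑ σ, f σ = ∑ c, ∑ d, f (pair hm c d) :=
  ((piFinTwoEquiv (choiceMatching 2 m hm).Choice).symm.sum_comp f).symm.trans
    (Fintype.sum_prod_type _)

theorem profileProb_eq (P : Protocol 2) (H : (choiceMatching 2 m hm).History)
    (σ : (choiceMatching 2 m hm).Profile) :
    P.profileProb (choiceMatching 2 m hm) H σ =
      rowProb P H 0 (row σ 0) * rowProb P H 1 (row σ 1) :=
  Fin.prod_univ_two _

theorem mem_win {σ : (choiceMatching 2 m hm).Profile} :
    σ ∈ (choiceMatching 2 m hm).Win ↔ row σ 0 = row σ 1 := by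
  refine Iff.trans (exists_congr fun a => Fin.forall_fin_two) ⟨?_, fun h => ⟨row σ 1, h, rfl⟩⟩
  rintro ⟨a, h0, h1⟩
  exact h0.trans h1.symm

theorem not_isFinal_iff :
    ¬ (choiceMatching 2 m hm).IsFinal H ↔ ∀ σ ∈ H, row σ 0 ≠ row σ 1 := by
  simp only [IsFinal, mem_win, not_exists, not_and, ne_eq]

theorem not_isFinal_nil : ¬ (choiceMatching 2 m hm).IsFinal [] := by
  simp [IsFinal]

theorem isFinal_cons_of_row_eq {σ : (choiceMatching 2 m hm).Profile} (hσ : row σ 0 = row σ 1) :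
    (choiceMatching 2 m hm).IsFinal (σ :: H) :=
  ⟨σ, List.mem_cons_self, mem_win.2 hσ⟩

theorem not_isFinal_cons {σ : (choiceMatching 2 m hm).Profile}
    (h : ¬ (choiceMatching 2 m hm).IsFinal H) (hσ : row σ 0 ≠ row σ 1) :
    ¬ (choiceMatching 2 m hm).IsFinal (σ :: H) := by
  rw [not_isFinal_iff] at h ⊢
  exact List.forall_mem_cons.2 ⟨hσ, h⟩

theorem touched_eq_union (H : (choiceMatching 2 m hm).History) (i : Fin 2) :
    touched H = chosenRows H i ∪ chosenRows H i.rev := by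
  ext c
  fin_cases i <;> simp [touched, or_comm]

theorem touched_cons (σ : (choiceMatching 2 m hm).Profile) :
    touched (σ :: H) = insert (row σ 0) (insert (row σ 1) (touched H)) := by
  ext c
  simp only [mem_touched, List.mem_cons, exists_eq_or_imp, Finset.mem_insert, Fin.exists_fin_two,
    eq_comm (b := c), or_assoc]

theorem touched_cons_of_mem {σ : (choiceMatching 2 m hm).Profile} (h0 : row σ 0 ∈ touched H)
    (h1 : row σ 1 ∈ touched H) : touched (σ :: H) = touched H := by
  rw [touched_cons, Finset.insert_eq_of_mem h1, Finset.insert_eq_of_mem h0]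

theorem sum_profileProb_of_row_ne (P : Protocol 2) (H : (choiceMatching 2 m hm).History) :
    ∑ σ, (if row σ 0 = row σ 1 then 0 else P.profileProb (choiceMatching 2 m hm) H σ) =
      1 - ∑ c, rowProb P H 0 c * rowProb P H 1 c := by
  have hcompl (c d : Fin m) : (if c = d then 0 else rowProb P H 0 c * rowProb P H 1 d) =
      rowProb P H 0 c * rowProb P H 1 d -
        if c = d then rowProb P H 0 c * rowProb P H 1 d else 0 := by
    split_ifs <;> ring
  simp only [profileProb_eq]
  rw [sum_profile]
  change ∑ c, ∑ d, (if c = d then 0 else rowProb P H 0 c * rowProb P H 1 d) = _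
  simp only [hcompl, Finset.sum_sub_distrib, Finset.sum_ite_eq, Finset.mem_univ, if_true,
    ← Finset.mul_sum, sum_rowProb, mul_one]

theorem nextMean_eq_of_forall {f : (choiceMatching 2 m hm).History → ℝ≥0∞} {t : ℝ≥0∞}
    (hfinal : ∀ σ, row σ 0 = row σ 1 → f (σ :: H) = 0)
    (hf : ∀ σ, row σ 0 ≠ row σ 1 → 0 < P.profileProb (choiceMatching 2 m hm) H σ →
      f (σ :: H) = t) :
    P.nextMean (choiceMatching 2 m hm) H f =
      ENNReal.ofReal (1 - ∑ c, rowProb P H 0 c * rowProb P H 1 c) * t := by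
  rw [← sum_profileProb_of_row_ne, ENNReal.ofReal_sum_of_nonneg, Finset.sum_mul]
  · refine Finset.sum_congr rfl fun σ _ => ?_
    split_ifs with hσ
    · simp [hfinal σ hσ]
    · rcases (P.profileProb_nonneg _ H σ).eq_or_lt with hzero | hpos
      · simp [← hzero]
      · rw [hf σ hσ hpos]
  · intro σ _
    split_ifs
    exacts [le_rfl, P.profileProb_nonneg _ H σ]

/-- The permutation `τ` of the rows, combined with the exchange of the two players, is a renaming of
the stage to itself. Since `τ` moves precisely the touched rows, it is determined by the history. -/
structure IsSymmetry (H : (choiceMatching 2 m hm).History) (τ : Equiv.Perm (Fin m)) : Prop where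
  involutive : Function.Involutive τ
  support_eq : τ.support = touched H
  apply_row_zero : ∀ σ ∈ H, τ (row σ 0) = row σ 1

namespace IsSymmetry

variable {τ : Equiv.Perm (Fin m)} {σ : (choiceMatching 2 m hm).Profile}

theorem apply_row_one (h : IsSymmetry H τ) (hσ : σ ∈ H) : τ (row σ 1) = row σ 0 := by
  rw [← h.apply_row_zero σ hσ, h.involutive]

theorem apply_ne_iff (h : IsSymmetry H τ) {c : Fin m} : τ c ≠ c ↔ c ∈ touched H := by
  rw [← h.support_eq, Equiv.Perm.mem_support]

theorem apply_of_notMem (h : IsSymmetry H τ) {c : Fin m} (hc : c ∉ touched H) : τ c = c :=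
  Equiv.Perm.notMem_support.1 (h.support_eq ▸ hc)

theorem apply_mem_touched (h : IsSymmetry H τ) {c : Fin m} : τ c ∈ touched H ↔ c ∈ touched H := by
  rw [← h.support_eq, Equiv.Perm.apply_mem_support]

theorem not_isFinal (h : IsSymmetry H τ) : ¬ (choiceMatching 2 m hm).IsFinal H := by
  rw [not_isFinal_iff]
  intro σ hσ
  rw [← h.apply_row_zero σ hσ]
  exact (h.apply_ne_iff.2 (row_mem_touched hσ 0)).symm

theorem rowProb_one (h : IsSymmetry H τ) (hP : P.IsStructural) (c : Fin m) :
    rowProb P H 1 c = rowProb P H 0 (τ c) :=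
  rowProb_apply_eq hP (Equiv.swap 0 1) τ
    (fun σ hσ => Fin.forall_fin_two.2 ⟨h.apply_row_one hσ, h.apply_row_zero σ hσ⟩) 0 c

theorem touched_cons_eq (h : IsSymmetry H τ) (h0 : row σ 0 ∈ touched H)
    (h1 : τ (row σ 0) = row σ 1) : touched (σ :: H) = touched H :=
  touched_cons_of_mem h0 (h1 ▸ h.apply_mem_touched.2 h0)

theorem cons_of_mem (h : IsSymmetry H τ) (h0 : row σ 0 ∈ touched H)
    (h1 : τ (row σ 0) = row σ 1) : IsSymmetry (σ :: H) τ where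
  involutive := h.involutive
  support_eq := h.support_eq.trans (h.touched_cons_eq h0 h1).symm
  apply_row_zero := List.forall_mem_cons.2 ⟨h1, h.apply_row_zero⟩

theorem cons_of_notMem (h : IsSymmetry H τ) (h0 : row σ 0 ∉ touched H) (h1 : row σ 1 ∉ touched H)
    (hne : row σ 0 ≠ row σ 1) :
    IsSymmetry (σ :: H) (τ * Equiv.swap (row σ 0) (row σ 1)) := by
  have hdisj : τ.Disjoint (Equiv.swap (row σ 0) (row σ 1)) := by
    rw [Equiv.Perm.disjoint_iff_disjoint_support, Equiv.Perm.support_swap hne, h.support_eq,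
      Finset.disjoint_insert_right, Finset.disjoint_singleton_right]
    exact ⟨h0, h1⟩
  refine ⟨fun c => ?_, ?_, List.forall_mem_cons.2 ⟨?_, fun ρ hρ => ?_⟩⟩
  · have hcomm := DFunLike.congr_fun hdisj.commute.eq (Equiv.swap (row σ 0) (row σ 1) c)
    simp only [Equiv.Perm.mul_apply] at hcomm ⊢
    rw [← hcomm, h.involutive, Equiv.swap_apply_self]
  · rw [hdisj.support_mul, h.support_eq, Equiv.Perm.support_swap hne, touched_cons,
      Finset.union_comm, Finset.insert_union, Finset.singleton_union]
  · rw [Equiv.Perm.mul_apply, Equiv.swap_apply_left, h.apply_of_notMem h1]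
  · rw [Equiv.Perm.mul_apply, Equiv.swap_apply_of_ne_of_ne
      (ne_of_mem_of_not_mem (row_mem_touched hρ 0) h0)
      (ne_of_mem_of_not_mem (row_mem_touched hρ 0) h1), h.apply_row_zero ρ hρ]

end IsSymmetry

theorem card_compl_touched_cons {σ : (choiceMatching 2 m hm).Profile} (h0 : row σ 0 ∉ touched H)
    (h1 : row σ 1 ∉ touched H) (hne : row σ 0 ≠ row σ 1) :
    (touched (σ :: H))ᶜ.card = (touched H)ᶜ.card - 2 := by
  rw [touched_cons, Finset.card_compl, Finset.card_compl,
    Finset.card_insert_of_notMem (by simp [hne, h0]), Finset.card_insert_of_notMem h1]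
  omega

theorem exists_isSymmetry_swap (h : ¬ (choiceMatching 2 m hm).IsFinal H)
    (hcard : (touched H).card = 2) :
    ∃ a b, a ≠ b ∧ touched H = {a, b} ∧ IsSymmetry H (Equiv.swap a b) := by
  obtain ⟨a, b, hab, htouched⟩ := Finset.card_eq_two.1 hcard
  refine ⟨a, b, hab, htouched, Equiv.swap_apply_self a b,
    (Equiv.Perm.support_swap hab).trans htouched.symm, fun σ hσ => ?_⟩
  have hmem (i : Fin 2) : row σ i = a ∨ row σ i = b := by
    simpa [htouched] using row_mem_touched hσ i
  have hne := not_isFinal_iff.1 h σ hσ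
  rcases hmem 0 with h0 | h0 <;> rcases hmem 1 with h1 | h1 <;> simp_all

/-- A lower bound for the expected coordination time from a symmetric stage with `u` untouched rows.
Coin tosses between paired rows take `2` rounds on average, and moving to untouched rows can be
faster only if `u < 4`. The value `3 / 2` is not sharp. -/
noncomputable def symmetricBound (u : ℕ) : ℝ := if 4 ≤ u then 2 else if 2 ≤ u then 3 / 2 else 1

theorem one_le_symmetricBound (u : ℕ) : 1 ≤ symmetricBound u := by
  unfold symmetricBound; split_ifs <;> norm_num

theorem symmetricBound_le_two (u : ℕ) : symmetricBound u ≤ 2 := by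
  unfold symmetricBound; split_ifs <;> norm_num

theorem symmetricBound_of_four_le {u : ℕ} (hu : 4 ≤ u) : symmetricBound u = 2 :=
  if_pos hu

/-- Here `y` is the probability of each of the `u` untouched rows, and `q` is the sum of the squared
probabilities of the touched rows. -/
theorem symmetricBound_add_le {u : ℕ} {y q : ℝ} (hy : 0 ≤ y) (huy : u * y ≤ 1)
    (hq : q ≤ (1 - u * y) ^ 2) :
    symmetricBound u + (if 4 ≤ u then (u * y) ^ 2 / 8 else 0) ≤
      2 - q - u * y ^ 2 + (symmetricBound u - 1) * q +
        (symmetricBound (u - 2) - 1) * (u * y * (u * y - y)) := by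
  have hmix : 0 ≤ u * y * (1 - u * y) := mul_nonneg (by positivity) (sub_nonneg.2 huy)
  rcases lt_or_ge u 6 with hu | hu
  · interval_cases u <;> norm_num [symmetricBound] at huy hq hmix ⊢ <;> nlinarith
  · have huy6 : 6 * (u * y ^ 2) ≤ (u * y) ^ 2 := by
      rw [mul_pow, sq (u : ℝ), mul_assoc]
      gcongr
      exact_mod_cast hu
    rw [symmetricBound_of_four_le (by omega), symmetricBound_of_four_le (by omega),
      if_pos (by omega)]
    nlinarith

open Classical in
/-- A lower bound for the expected coordination time of all structural protocols. -/
noncomputable def lowerBound (H : (choiceMatching 2 m hm).History) : ℝ :=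
  if (choiceMatching 2 m hm).IsFinal H then 0
  else if ∃ τ, IsSymmetry H τ then symmetricBound (touched H)ᶜ.card else 1

theorem lowerBound_of_isFinal (h : (choiceMatching 2 m hm).IsFinal H) : lowerBound H = 0 :=
  if_pos h

theorem IsSymmetry.lowerBound_eq {τ : Equiv.Perm (Fin m)} (h : IsSymmetry H τ) :
    lowerBound H = symmetricBound (touched H)ᶜ.card := by
  rw [lowerBound, if_neg h.not_isFinal, if_pos ⟨τ, h⟩]

theorem one_le_lowerBound (h : ¬ (choiceMatching 2 m hm).IsFinal H) : 1 ≤ lowerBound H := by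
  rw [lowerBound, if_neg h]
  split_ifs
  exacts [one_le_symmetricBound _, le_rfl]

theorem lowerBound_nonneg (H : (choiceMatching 2 m hm).History) : 0 ≤ lowerBound H := by
  by_cases h : (choiceMatching 2 m hm).IsFinal H
  · rw [lowerBound_of_isFinal h]
  · exact zero_le_one.trans (one_le_lowerBound h)

theorem lowerBound_le_two (H : (choiceMatching 2 m hm).History) : lowerBound H ≤ 2 := by
  unfold lowerBound
  split_ifs
  exacts [zero_le_two, symmetricBound_le_two _, one_le_two]

namespace IsSymmetry

variable {τ : Equiv.Perm (Fin m)} {c : Fin m}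

theorem le_lowerBound_cons_of_mem (h : IsSymmetry H τ) (hc : c ∈ touched H) (d : Fin m) :
    1 - (if d = τ c then 1 else 0) +
      (if d = c then symmetricBound (touched H)ᶜ.card - 1 else 0) ≤
      lowerBound (pair hm c (τ d) :: H) := by
  have hcc : τ c ≠ c := h.apply_ne_iff.2 hc
  by_cases hwin : d = τ c
  · subst hwin
    simpa [hcc] using lowerBound_nonneg (pair hm c (τ (τ c)) :: H)
  by_cases hd : d = c
  · subst hd
    rw [(h.cons_of_mem (σ := pair hm d (τ d)) hc rfl).lowerBound_eq,
      h.touched_cons_eq (σ := pair hm d (τ d)) hc rfl]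
    simp [hcc.symm]
  · have hne : c ≠ τ d := fun e => hwin (h.involutive.eq_iff.1 e.symm)
    simpa [hwin, hd] using
      one_le_lowerBound (not_isFinal_cons (σ := pair hm c (τ d)) h.not_isFinal hne)

theorem le_lowerBound_cons_of_notMem (h : IsSymmetry H τ) (hc : c ∉ touched H) (d : Fin m) :
    1 - (if d = c then 1 else 0) +
      (if d ∈ (touched H)ᶜ.erase c then symmetricBound ((touched H)ᶜ.card - 2) - 1 else 0) ≤
      lowerBound (pair hm c (τ d) :: H) := by
  by_cases hwin : d = c
  · simpa [hwin] using lowerBound_nonneg (pair hm c (τ d) :: H)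
  have hne : c ≠ τ d := fun e => hwin (τ.injective (e.symm.trans (h.apply_of_notMem hc).symm))
  by_cases hd : d ∈ touched H
  · simpa [hwin, hd] using
      one_le_lowerBound (not_isFinal_cons (σ := pair hm c (τ d)) h.not_isFinal hne)
  · have hτd : τ d ∉ touched H := mt h.apply_mem_touched.1 hd
    rw [(h.cons_of_notMem (σ := pair hm c (τ d)) hc hτd hne).lowerBound_eq,
      card_compl_touched_cons (σ := pair hm c (τ d)) hc hτd hne]
    simp [hwin, hd]

theorem le_sum_lowerBound_cons_of_mem (h : IsSymmetry H τ) {x : Fin m → ℝ} (hx : ∀ d, 0 ≤ x d)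
    (hsum : ∑ d, x d = 1) (hc : c ∈ touched H) :
    1 - x (τ c) + (symmetricBound (touched H)ᶜ.card - 1) * x c ≤
      ∑ d, x d * lowerBound (pair hm c (τ d) :: H) :=
  calc 1 - x (τ c) + (symmetricBound (touched H)ᶜ.card - 1) * x c
    _ = ∑ d, x d * (1 - (if d = τ c then 1 else 0) +
          (if d = c then symmetricBound (touched H)ᶜ.card - 1 else 0)) := by
      simp [mul_add, mul_sub, Finset.sum_add_distrib, hsum, mul_comm]
    _ ≤ _ := Finset.sum_le_sum fun d _ =>
      mul_le_mul_of_nonneg_left (h.le_lowerBound_cons_of_mem hc d) (hx d)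

theorem le_sum_lowerBound_cons_of_notMem (h : IsSymmetry H τ) {x : Fin m → ℝ} (hx : ∀ d, 0 ≤ x d)
    (hsum : ∑ d, x d = 1) (hc : c ∉ touched H) :
    1 - x c + (symmetricBound ((touched H)ᶜ.card - 2) - 1) *
        (∑ d ∈ (touched H)ᶜ, x d - x c) ≤
      ∑ d, x d * lowerBound (pair hm c (τ d) :: H) :=
  calc 1 - x c + (symmetricBound ((touched H)ᶜ.card - 2) - 1) * (∑ d ∈ (touched H)ᶜ, x d - x c)
    _ = ∑ d, x d * (1 - (if d = c then 1 else 0) +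
          (if d ∈ (touched H)ᶜ.erase c then symmetricBound ((touched H)ᶜ.card - 2) - 1
            else 0)) := by
      rw [← Finset.sum_erase_eq_sub (Finset.mem_compl.2 hc)]
      simp only [mul_add, mul_sub, mul_ite, mul_one, mul_zero, Finset.sum_add_distrib,
        Finset.sum_sub_distrib, hsum, Finset.sum_ite_eq', Finset.sum_ite_mem, Finset.univ_inter,
        Finset.mem_univ, if_true, ← Finset.sum_mul]
      ring
    _ ≤ _ := Finset.sum_le_sum fun d _ =>
      mul_le_mul_of_nonneg_left (h.le_lowerBound_cons_of_notMem hc d) (hx d)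

theorem sum_profileProb_mul (h : IsSymmetry H τ) (hP : P.IsStructural)
    (f : (choiceMatching 2 m hm).Profile → ℝ) :
    ∑ σ, P.profileProb (choiceMatching 2 m hm) H σ * f σ =
      ∑ c, rowProb P H 0 c * ∑ d, rowProb P H 0 d * f (pair hm c (τ d)) := by
  simp only [sum_profile, profileProb_eq, row_pair_zero, row_pair_one, mul_assoc, Finset.mul_sum]
  refine Finset.sum_congr rfl fun c _ => ?_
  rw [← Equiv.sum_comp τ]
  simp only [h.rowProb_one hP, h.involutive _]

theorem sum_sq_sub_apply (h : IsSymmetry H τ) (x : Fin m → ℝ) :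
    ∑ c ∈ touched H, (x c - x (τ c)) ^ 2 =
      2 * (∑ c ∈ touched H, x c ^ 2 - ∑ c ∈ touched H, x c * x (τ c)) := by
  have hτ : ∑ c ∈ touched H, x (τ c) ^ 2 = ∑ c ∈ touched H, x c ^ 2 :=
    Finset.sum_equiv τ (fun c => h.apply_mem_touched.symm) fun c _ => rfl
  simp only [sub_sq, Finset.sum_add_distrib, Finset.sum_sub_distrib, hτ, mul_assoc,
    ← Finset.mul_sum]
  ring

theorem le_one_add_sum_lowerBound_cons (h : IsSymmetry H τ) (hP : P.IsStructural) {y : ℝ}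
    (hy : ∀ c ∉ touched H, rowProb P H 0 c = y) :
    2 - ∑ c ∈ touched H, rowProb P H 0 c * rowProb P H 0 (τ c) - (touched H)ᶜ.card * y ^ 2 +
        (symmetricBound (touched H)ᶜ.card - 1) * ∑ c ∈ touched H, rowProb P H 0 c ^ 2 +
        (symmetricBound ((touched H)ᶜ.card - 2) - 1) *
          ((touched H)ᶜ.card * y * ((touched H)ᶜ.card * y - y)) ≤
      1 + ∑ σ, P.profileProb (choiceMatching 2 m hm) H σ * lowerBound (σ :: H) := by
  set x := rowProb P H 0
  have hx : ∀ c, 0 ≤ x c := rowProb_nonneg P H 0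
  have hsum : ∑ c, x c = 1 := sum_rowProb P H 0
  have hcompl : ∑ c ∈ (touched H)ᶜ, x c = (touched H)ᶜ.card * y := by
    rw [Finset.sum_eq_card_nsmul fun c hc => hy c (Finset.mem_compl.1 hc), nsmul_eq_mul]
  have hmem := Finset.sum_le_sum fun c (hc : c ∈ touched H) =>
    mul_le_mul_of_nonneg_left (h.le_sum_lowerBound_cons_of_mem hx hsum hc) (hx c)
  have hnotMem := Finset.sum_le_sum fun c (hc : c ∈ (touched H)ᶜ) =>
    mul_le_mul_of_nonneg_left
      (h.le_sum_lowerBound_cons_of_notMem hx hsum (Finset.mem_compl.1 hc)) (hx c)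
  have hmem_eq : ∑ c ∈ touched H, x c *
      (1 - x (τ c) + (symmetricBound (touched H)ᶜ.card - 1) * x c) =
        ∑ c ∈ touched H, x c - ∑ c ∈ touched H, x c * x (τ c) +
          (symmetricBound (touched H)ᶜ.card - 1) * ∑ c ∈ touched H, x c ^ 2 := by
    rw [Finset.mul_sum, ← Finset.sum_sub_distrib, ← Finset.sum_add_distrib]
    exact Finset.sum_congr rfl fun c _ => by ring
  rw [hmem_eq] at hmem
  rw [hcompl, Finset.sum_congr rfl fun c hc => by rw [hy c (Finset.mem_compl.1 hc)],
    Finset.sum_const, nsmul_eq_mul] at hnotMem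
  rw [← Finset.sum_add_sum_compl (touched H), hcompl] at hsum
  rw [h.sum_profileProb_mul hP, ← Finset.sum_add_sum_compl (touched H)]
  linarith

theorem lowerBound_add_le (h : IsSymmetry H τ) (hP : P.IsStructural) :
    lowerBound H + (∑ c ∈ touched H, (rowProb P H 0 c - rowProb P H 0 (τ c)) ^ 2) / 2 +
        (if 4 ≤ (touched H)ᶜ.card then (∑ c ∈ (touched H)ᶜ, rowProb P H 0 c) ^ 2 / 8 else 0) ≤
      1 + ∑ σ, P.profileProb (choiceMatching 2 m hm) H σ * lowerBound (σ :: H) := by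
  obtain ⟨y, hy0, hy⟩ : ∃ y, 0 ≤ y ∧ ∀ c ∉ touched H, rowProb P H 0 c = y := by
    by_cases hne : ∃ c, c ∉ touched H
    · obtain ⟨c, hc⟩ := hne
      exact ⟨_, rowProb_nonneg P H 0 c, fun d hd => rowProb_eq_of_notMem_touched hP 0 hd hc⟩
    · exact ⟨0, le_rfl, fun c hc => (hne ⟨c, hc⟩).elim⟩
  have hcompl : ∑ c ∈ (touched H)ᶜ, rowProb P H 0 c = (touched H)ᶜ.card * y := by
    rw [Finset.sum_eq_card_nsmul fun c hc => hy c (Finset.mem_compl.1 hc), nsmul_eq_mul]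
  have htouched : ∑ c ∈ touched H, rowProb P H 0 c = 1 - (touched H)ᶜ.card * y := by
    rw [← hcompl, eq_sub_iff_add_eq, Finset.sum_add_sum_compl, sum_rowProb]
  have hmass : (touched H)ᶜ.card * y ≤ 1 :=
    sub_nonneg.1 (htouched ▸ Finset.sum_nonneg fun c _ => rowProb_nonneg P H 0 c)
  have hsq : ∑ c ∈ touched H, rowProb P H 0 c ^ 2 ≤ (1 - (touched H)ᶜ.card * y) ^ 2 :=
    htouched ▸ Finset.sum_sq_le_sq_sum_of_nonneg fun c _ => rowProb_nonneg P H 0 c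
  rw [h.lowerBound_eq, h.sum_sq_sub_apply, hcompl]
  linarith [h.le_one_add_sum_lowerBound_cons hP hy, symmetricBound_add_le hy0 hmass hsq]

end IsSymmetry

theorem lowerBound_le_one_add_sum (hP : P.IsStructural) (h : ¬ (choiceMatching 2 m hm).IsFinal H) :
    lowerBound H ≤ 1 + ∑ σ, P.profileProb (choiceMatching 2 m hm) H σ * lowerBound (σ :: H) := by
  by_cases hsymm : ∃ τ, IsSymmetry H τ
  · obtain ⟨τ, hτ⟩ := hsymm
    refine le_trans ?_ (hτ.lowerBound_add_le hP)
    rw [add_assoc, le_add_iff_nonneg_right]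
    split_ifs <;> positivity
  · rw [lowerBound, if_neg h, if_neg hsymm, le_add_iff_nonneg_right]
    exact Finset.sum_nonneg fun σ _ =>
      mul_nonneg (P.profileProb_nonneg _ H σ) (lowerBound_nonneg _)

theorem ofReal_one_add_sum_lowerBound (P : Protocol 2) (H : (choiceMatching 2 m hm).History) :
    ENNReal.ofReal
        (1 + ∑ σ, P.profileProb (choiceMatching 2 m hm) H σ * lowerBound (σ :: H)) =
      1 + P.nextMean (choiceMatching 2 m hm) H fun H => ENNReal.ofReal (lowerBound H) := by
  rw [P.nextMean_ofReal _ lowerBound_nonneg, ENNReal.ofReal_add zero_le_one, ENNReal.ofReal_one]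
  exact Finset.sum_nonneg fun σ _ => mul_nonneg (P.profileProb_nonneg _ H σ) (lowerBound_nonneg _)

theorem lowerBound_le_ect (hP : P.IsStructural) (H : (choiceMatching 2 m hm).History) :
    ENNReal.ofReal (lowerBound H) ≤ P.ect (choiceMatching 2 m hm) H := by
  refine P.le_ect_of_le_one_add_nextMean _
    (f := fun H => ENNReal.ofReal (lowerBound H)) (b := ENNReal.ofReal 2)
    (fun H => ENNReal.ofReal_le_ofReal (lowerBound_le_two H)) ENNReal.ofReal_ne_top
    (fun H h => by rw [lowerBound_of_isFinal h, ENNReal.ofReal_zero]) (fun H h => ?_) H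
  rw [← ofReal_one_add_sum_lowerBound]
  exact ENNReal.ofReal_le_ofReal (lowerBound_le_one_add_sum hP h)

theorem one_add_nextMean_lowerBound_le_ect (hP : P.IsStructural)
    (h : ¬ (choiceMatching 2 m hm).IsFinal H) :
    1 + P.nextMean (choiceMatching 2 m hm) H (fun H => ENNReal.ofReal (lowerBound H)) ≤
      P.ect (choiceMatching 2 m hm) H := by
  rw [P.ect_of_not_isFinal _ h]
  gcongr
  exact P.nextMean_mono _ (lowerBound_le_ect hP)

theorem coordinating_eq (i : Fin 2) :
    coordinating (choiceMatching 2 m hm) H i = chosenRows H i.rev := by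
  ext c
  refine mem_coordinating.trans ((exists_congr fun ρ => and_congr_right fun _ => ⟨?_, ?_⟩).trans
    mem_chosenRows.symm)
  · rintro ⟨σ, ⟨a, ha⟩, hc, hρ⟩
    exact hρ.symm.trans ((ha _).trans ((ha i).symm.trans hc))
  · intro hρ
    exact ⟨fun _ => c, ⟨c, fun _ => rfl⟩, rfl, hρ.symm⟩

theorem rowProb_waitOrMove (H : (choiceMatching 2 m hm).History) (i : Fin 2) (c : Fin m) :
    rowProb waitOrMove H i c =
      if ∀ j, (chosenRows H j).card = 1 then
        (if c ∈ chosenRows H i then 1 / 2 else 0) +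
          if c ∈ chosenRows H i.rev then 1 / (2 * ((chosenRows H i.rev).card : ℝ)) else 0
      else if ∀ j, (chosenRows H j).card = 2 then if c ∈ chosenRows H i then 1 / 2 else 0
      else 1 / m := by
  have hcard : Fintype.card ((choiceMatching 2 m hm).Choice i) = m := Fintype.card_fin m
  change WaitOrMove.prob (choiceMatching 2 m hm) H i c = _
  unfold WaitOrMove.prob
  rw [coordinating_eq, hcard]
  congr!

theorem rowProb_waitOrMove_of_card_eq_one (h : ∀ j, (chosenRows H j).card = 1) (i : Fin 2)
    (c : Fin m) :
    rowProb waitOrMove H i c =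
      (if c ∈ chosenRows H i then 1 / 2 else 0) + if c ∈ chosenRows H i.rev then 1 / 2 else 0 := by
  rw [rowProb_waitOrMove, if_pos h, h, Nat.cast_one, mul_one]

theorem rowProb_waitOrMove_of_card_eq_two (h : ∀ j, (chosenRows H j).card = 2) (i : Fin 2)
    (c : Fin m) : rowProb waitOrMove H i c = if c ∈ chosenRows H i then 1 / 2 else 0 := by
  rw [rowProb_waitOrMove, if_neg (fun h1 => by simpa [h] using h1 i), if_pos h]

theorem IsSymmetry.card_chosenRows_rev {τ : Equiv.Perm (Fin m)} (h : IsSymmetry H τ) (i : Fin 2) :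
    (chosenRows H i.rev).card = (chosenRows H i).card := by
  have hmap : chosenRows H 1 = (chosenRows H 0).map τ.toEmbedding := by
    ext c
    simp only [Finset.mem_map, mem_chosenRows, Equiv.coe_toEmbedding, exists_exists_and_eq_and]
    exact exists_congr fun σ => and_congr_right fun hσ => by rw [h.apply_row_zero σ hσ]
  fin_cases i <;> simp [hmap]

/-- Either one row was chosen by each player, and the two rows are different, or both players chose
both rows: in the first case waiting and moving select the two rows. -/
theorem rowProb_waitOrMove_of_card_touched (h : ¬ (choiceMatching 2 m hm).IsFinal H)
    (hcard : (touched H).card = 2) (i : Fin 2) (c : Fin m) :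
    rowProb waitOrMove H i c = if c ∈ touched H then 1 / 2 else 0 := by
  obtain ⟨a, b, -, -, hτ⟩ := exists_isSymmetry_swap h hcard
  have hrev := hτ.card_chosenRows_rev
  have hunion := touched_eq_union H i
  have hsub : chosenRows H i ⊆ touched H := hunion.symm ▸ Finset.subset_union_left
  have hle : (chosenRows H i).card ≤ 2 := (Finset.card_le_card hsub).trans_eq hcard
  have hge : 2 ≤ (chosenRows H i).card + (chosenRows H i.rev).card :=
    hcard.ge.trans ((congrArg Finset.card hunion).trans_le (Finset.card_union_le _ _))
  have hall {k : ℕ} (hk : (chosenRows H i).card = k) : ∀ j, (chosenRows H j).card = k := by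
    have hplayer : ∀ i j : Fin 2, j = i ∨ j = i.rev := by decide
    intro j
    rcases hplayer i j with rfl | rfl
    exacts [hk, (hrev _).trans hk]
  obtain hone | htwo : (chosenRows H i).card = 1 ∨ (chosenRows H i).card = 2 := by
    have := hrev i
    omega
  · have hdisj : Disjoint (chosenRows H i) (chosenRows H i.rev) := by
      rw [← Finset.card_union_eq_card_add_card, ← hunion, hcard, hrev, hone]
    rw [rowProb_waitOrMove_of_card_eq_one (hall hone), hunion]
    simp only [Finset.mem_union]
    by_cases hc : c ∈ chosenRows H i
    · simp [hc, Finset.disjoint_left.1 hdisj hc]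
    · simp [hc]
  · rw [rowProb_waitOrMove_of_card_eq_two (hall htwo),
      Finset.eq_of_subset_of_card_le hsub (by rw [hcard, htwo])]

theorem row_mem_touched_of_profileProb_pos (h : ¬ (choiceMatching 2 m hm).IsFinal H)
    (hcard : (touched H).card = 2) {σ : (choiceMatching 2 m hm).Profile}
    (hσ : 0 < waitOrMove.profileProb (choiceMatching 2 m hm) H σ) (i : Fin 2) :
    row σ i ∈ touched H := by
  by_contra hi
  refine hσ.ne' (Finset.prod_eq_zero (Finset.mem_univ i) ?_)
  exact (rowProb_waitOrMove_of_card_touched h hcard i _).trans (if_neg hi)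

theorem card_touched_singleton {σ : (choiceMatching 2 m hm).Profile} (hσ : row σ 0 ≠ row σ 1) :
    (touched [σ]).card = 2 := by
  have hnil : touched ([] : (choiceMatching 2 m hm).History) = ∅ := by
    ext; simp [mem_touched]
  rw [touched_cons, hnil]
  exact Finset.card_pair hσ

theorem eq_nil_or_card_touched_of_reachable
    (hH : waitOrMove.Reachable (choiceMatching 2 m hm) H)
    (h : ¬ (choiceMatching 2 m hm).IsFinal H) : H = [] ∨ (touched H).card = 2 := by
  induction hH with
  | initial => exact Or.inl rfl
  | step H σ _ hH hσ ih =>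
    right
    rcases ih hH with rfl | hcard
    · exact card_touched_singleton (mt isFinal_cons_of_row_eq h)
    · have hmem := row_mem_touched_of_profileProb_pos hH hcard hσ
      rwa [touched_cons_of_mem (hmem 0) (hmem 1)]

theorem nextMean_waitOrMove_of_card_touched (h : ¬ (choiceMatching 2 m hm).IsFinal H)
    (hcard : (touched H).card = 2) {f : (choiceMatching 2 m hm).History → ℝ≥0∞} {t : ℝ≥0∞}
    (hfinal : ∀ H, (choiceMatching 2 m hm).IsFinal H → f H = 0)
    (hf : ∀ H, ¬ (choiceMatching 2 m hm).IsFinal H → (touched H).card = 2 → f H = t) :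
    waitOrMove.nextMean (choiceMatching 2 m hm) H f = t / 2 := by
  rw [nextMean_eq_of_forall (fun σ hσ => hfinal _ (isFinal_cons_of_row_eq hσ)) (t := t)
    fun σ hσ hpos => hf _ (not_isFinal_cons h hσ) ?_]
  · simp only [rowProb_waitOrMove_of_card_touched h hcard, mul_ite, ite_mul, mul_zero, zero_mul,
      ← ite_and, and_self, Finset.sum_ite_mem, Finset.univ_inter, Finset.sum_const, hcard]
    have hhalf : 1 - (2 : ℕ) • (1 / 2 * (1 / 2)) = (2⁻¹ : ℝ) := by norm_num
    rw [hhalf, ENNReal.ofReal_inv_of_pos two_pos, ENNReal.ofReal_ofNat, ENNReal.div_eq_inv_mul]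
  · have hmem := row_mem_touched_of_profileProb_pos h hcard hpos
    rwa [touched_cons_of_mem (hmem 0) (hmem 1)]

open Classical in
theorem ect_waitOrMove_le_of_card_touched (h : ¬ (choiceMatching 2 m hm).IsFinal H)
    (hcard : (touched H).card = 2) : waitOrMove.ect (choiceMatching 2 m hm) H ≤ 2 := by
  have hle := waitOrMove.ect_le_of_one_add_nextMean_le (choiceMatching 2 m hm)
    (f := fun H => if (choiceMatching 2 m hm).IsFinal H then 0
      else if (touched H).card = 2 then 2 else ∞) (fun H h => ?_) H
  · simpa [h, hcard] using hle
  · by_cases hcard : (touched H).card = 2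
    · rw [nextMean_waitOrMove_of_card_touched h hcard (t := 2) (fun H h => if_pos h)
        fun H h hcard => (if_neg h).trans (if_pos hcard), if_neg h, if_pos hcard,
        ENNReal.div_self two_ne_zero ENNReal.ofNat_ne_top, one_add_one_eq_two]
    · simp [h, hcard]

theorem lowerBound_of_card_touched (hm6 : 6 ≤ m) (h : ¬ (choiceMatching 2 m hm).IsFinal H)
    (hcard : (touched H).card = 2) : lowerBound H = 2 := by
  obtain ⟨a, b, -, -, hτ⟩ := exists_isSymmetry_swap h hcard
  rw [hτ.lowerBound_eq, symmetricBound_of_four_le]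
  rw [Finset.card_compl, Fintype.card_fin, hcard]
  omega

theorem two_le_ect_of_card_touched (hm6 : 6 ≤ m) (hP : P.IsStructural)
    (h : ¬ (choiceMatching 2 m hm).IsFinal H) (hcard : (touched H).card = 2) :
    2 ≤ P.ect (choiceMatching 2 m hm) H := by
  simpa [lowerBound_of_card_touched hm6 h hcard] using lowerBound_le_ect hP H

theorem ect_waitOrMove_of_card_touched (hm6 : 6 ≤ m) (h : ¬ (choiceMatching 2 m hm).IsFinal H)
    (hcard : (touched H).card = 2) : waitOrMove.ect (choiceMatching 2 m hm) H = 2 :=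
  (ect_waitOrMove_le_of_card_touched h hcard).antisymm
    (two_le_ect_of_card_touched hm6 waitOrMove_isStructural h hcard)

theorem rowProb_eq_of_ect_le_two (hm6 : 6 ≤ m) (hP : P.IsStructural)
    (h : ¬ (choiceMatching 2 m hm).IsFinal H) (hcard : (touched H).card = 2)
    (hect : P.ect (choiceMatching 2 m hm) H ≤ 2) (i : Fin 2) (c : Fin m) :
    rowProb P H i c = if c ∈ touched H then 1 / 2 else 0 := by
  obtain ⟨a, b, hab, htouched, hτ⟩ := exists_isSymmetry_swap h hcard
  have hmean := (one_add_nextMean_lowerBound_le_ect hP h).trans hect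
  rw [← ofReal_one_add_sum_lowerBound, ENNReal.ofReal_le_ofNat] at hmean
  have hloss := (hτ.lowerBound_add_le hP).trans hmean
  have huntouched : 4 ≤ (touched H)ᶜ.card := by
    rw [Finset.card_compl, Fintype.card_fin, hcard]
    omega
  rw [lowerBound_of_card_touched hm6 h hcard, if_pos huntouched, htouched, Finset.sum_pair hab,
    Equiv.swap_apply_left, Equiv.swap_apply_right] at hloss
  have hmove : ∑ d ∈ ({a, b} : Finset (Fin m))ᶜ, rowProb P H 0 d = 0 := by nlinarith
  have hbias : rowProb P H 0 a = rowProb P H 0 b := by nlinarith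
  have hsum := sum_rowProb P H 0
  rw [← Finset.sum_add_sum_compl {a, b}, Finset.sum_pair hab, hmove] at hsum
  have hzero : ∀ d, rowProb P H 0 d = if d ∈ touched H then 1 / 2 else 0 := by
    intro d
    rw [htouched]
    split_ifs with hd
    · obtain rfl | rfl : d = a ∨ d = b := by simpa using hd
      all_goals linarith
    · exact (Finset.sum_eq_zero_iff_of_nonneg fun e _ => rowProb_nonneg P H 0 e).1 hmove d
        (Finset.mem_compl.2 hd)
  revert i
  rw [Fin.forall_fin_two]
  refine ⟨hzero c, ?_⟩
  simp only [hτ.rowProb_one hP, hzero, hτ.apply_mem_touched]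

theorem one_add_nextMean_nil (hP : P.IsStructural) {f : (choiceMatching 2 m hm).History → ℝ≥0∞}
    (hfinal : ∀ H, (choiceMatching 2 m hm).IsFinal H → f H = 0)
    (hf : ∀ H, ¬ (choiceMatching 2 m hm).IsFinal H → (touched H).card = 2 → f H = 2) :
    1 + P.nextMean (choiceMatching 2 m hm) [] f = ENNReal.ofReal (3 - 2 / (m : ℝ)) := by
  have hm0 : (1 : ℝ) ≤ m := by exact_mod_cast hm
  have hinv : 1 / (m : ℝ) ≤ 1 := by rwa [div_le_one (by linarith)]
  have hmatch : ∑ c : Fin m, 1 / (m : ℝ) * (1 / m) = 1 / m := by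
    rw [Finset.sum_const, Finset.card_univ, Fintype.card_fin, nsmul_eq_mul]
    field_simp
  rw [nextMean_eq_of_forall (fun σ hσ => hfinal _ (isFinal_cons_of_row_eq hσ)) (t := 2)
    fun σ hσ _ => hf _ (not_isFinal_cons not_isFinal_nil hσ) (card_touched_singleton hσ)]
  simp only [rowProb_nil hP, hmatch]
  rw [← ENNReal.ofReal_ofNat, ← ENNReal.ofReal_mul (sub_nonneg.2 hinv), ← ENNReal.ofReal_one,
    ← ENNReal.ofReal_add zero_le_one (by linarith)]
  congr 1
  ring

theorem ofReal_le_ect_nil (hm6 : 6 ≤ m) (hP : P.IsStructural) :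
    ENNReal.ofReal (3 - 2 / (m : ℝ)) ≤ P.ect (choiceMatching 2 m hm) [] := by
  rw [← one_add_nextMean_nil (hm := hm) hP (f := fun H => ENNReal.ofReal (lowerBound H))
    (fun H h => by simp [lowerBound_of_isFinal h])
    fun H h hcard => by simp [lowerBound_of_card_touched hm6 h hcard]]
  exact one_add_nextMean_lowerBound_le_ect hP not_isFinal_nil

theorem ect_waitOrMove_nil (hm6 : 6 ≤ m) :
    waitOrMove.ect (choiceMatching 2 m hm) [] = ENNReal.ofReal (3 - 2 / (m : ℝ)) := by
  rw [waitOrMove.ect_of_not_isFinal _ not_isFinal_nil,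
    one_add_nextMean_nil waitOrMove_isStructural (fun H h => waitOrMove.ect_of_isFinal _ h)
      fun H h hcard => ect_waitOrMove_of_card_touched hm6 h hcard]

theorem ect_waitOrMove_le_ect_of_reachable (hm6 : 6 ≤ m) (hP : P.IsStructural)
    (hH : waitOrMove.Reachable (choiceMatching 2 m hm) H) :
    waitOrMove.ect (choiceMatching 2 m hm) H ≤ P.ect (choiceMatching 2 m hm) H := by
  by_cases h : (choiceMatching 2 m hm).IsFinal H
  · simp [waitOrMove.ect_of_isFinal _ h]
  rcases eq_nil_or_card_touched_of_reachable hH h with rfl | hcard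
  · exact (ect_waitOrMove_nil hm6).trans_le (ofReal_le_ect_nil hm6 hP)
  · exact (ect_waitOrMove_of_card_touched hm6 h hcard).trans_le
      (two_le_ect_of_card_touched hm6 hP h hcard)

theorem rowProb_eq_waitOrMove_of_ect_le (hm6 : 6 ≤ m) (hP : P.IsStructural)
    (hH : waitOrMove.Reachable (choiceMatching 2 m hm) H)
    (h : ¬ (choiceMatching 2 m hm).IsFinal H)
    (hect : P.ect (choiceMatching 2 m hm) H ≤ waitOrMove.ect (choiceMatching 2 m hm) H)
    (i : Fin 2) (c : Fin m) : rowProb P H i c = rowProb waitOrMove H i c := by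
  rcases eq_nil_or_card_touched_of_reachable hH h with rfl | hcard
  · rw [rowProb_nil hP, rowProb_nil waitOrMove_isStructural]
  · rw [ect_waitOrMove_of_card_touched hm6 h hcard] at hect
    rw [rowProb_eq_of_ect_le_two hm6 hP h hcard hect, rowProb_waitOrMove_of_card_touched h hcard]

end TwoPlayers

end ChoiceMatching

open ChoiceMatching in
theorem mainTheorem3 (m : ℕ) (hm : 6 ≤ m) :
    waitOrMove.IsUniquelyECTOptimal (choiceMatching 2 m (by omega)) ∧
      waitOrMove.ect (choiceMatching 2 m (by omega)) [] = ENNReal.ofReal (3 - 2 / (m : ℝ)) := by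
  refine ⟨Protocol.isUniquelyECTOptimal_of_forall_reachable WaitOrMove.waitOrMove_isStructural
    ?_ ?_ ?_, ect_waitOrMove_nil hm⟩
  · exact (ect_waitOrMove_nil hm).trans_ne ENNReal.ofReal_ne_top
  · exact fun H hH Q hQ => ect_waitOrMove_le_ect_of_reachable hm hQ hH
  · exact fun H hH h Q hQ hle => rowProb_eq_waitOrMove_of_ect_le hm hQ hH h hle
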